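/- Let $\mathcal H$ be the set of functions $h:[0,1]\to\mathbb R$ of bounded variation with $h(0)=0$ (distortion functions). For $h\in\mathcal H$ and a real random variable $Y$ with finite mean, let $$\rho_h(Y)=\int_0^\infty h(\mathbb P(Y>x))\,\mathrm dx+\int_{-\infty}^0\bigl(h(\mathbb P(Y>x))-h(1)\bigr)\,\mathrm dx ,$$ with values in $[-\infty,\infty]$ (a $Y$ for which the positive and the negative part of the integrand both have infinite integral is disregarded in suprema of $\rho_h$), and let the concave envelope $h^*$ be $$h^*(t)=\inf\{g(t): g\in\mathcal H,\ g\ge h,\ g\text{ concave on }[0,1]\},\qquad t\in[0,1].$$ For a distribution $F$ on $\mathbb R$ with finite mean and left-quantile function $F^{-1}$, and an interval $C\subseteq[0,1]$, the $C$-concentration $F^C$ is the distribution of $$F^{-1}(U)\mathbf 1_{\{U\notin C\}}+\mathbb E[F^{-1}(U)\mid U\in C]\,\mathbf 1_{\{U\in C\}},$$ where $U$ is uniform on $[0,1]$ (so $F^C=F$ if $C$ has length $0$). A set $\mathcal M$ of distributions on $\mathbb R$ with finite mean is closed under concentration if $F^C\in\mathcal M$ for all $F\in\mathcal M$ and all intervals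 $C\subseteq[0,1]$. Let $d,n\in\mathbb N$, let $A\subseteq\mathbb R^d$, let $\widetilde{\mathcal M}$ be a set of distributions on $\mathbb R^n$ with finite first moment, and let $f:\mathbb R^d\times\mathbb R^n\to\mathbb R$ be such that, for every $\mathbf a\in A$, $f(\mathbf a,\cdot)$ is measurable and $f(\mathbf a,\mathbf X)$ has finite mean whenever $F_{\mathbf X}\in\widetilde{\mathcal M}$. Suppose that for every $\mathbf a\in A$ the set $\{F_{f(\mathbf a,\mathbf X)}:F_{\mathbf X}\in\widetilde{\mathcal M}\}$ is closed under concentration. Then for every $\mathcal G\subseteq\mathcal H$, $$\min_{\mathbf a\in A}\ \sup_{F_{\mathbf X}\in\widetilde{\mathcal M}}\ \sup_{h\in\mathcal G}\rho_h(f(\mathbf a,\mathbf X))=\min_{\mathbf a\in A}\ \sup_{F_{\mathbf X}\in\widetilde{\mathcal M}}\ \sup_{h\in\mathcal G}\rho_{h^*}(f(\mathbf a,\mathbf X)),$$ in the sense that the two infima over $A$ are equal in $[-\infty,\infty]$, and a value is the attained minimum of the left-hand problem if and only if it is the attained minimum of the right-hand problem. -/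

import Mathlib

open MeasureTheory ProbabilityTheory Set

noncomputable section

/-- The set of distributions on `E` (meant: `ℝ` or `ℝⁿ`) with finite first moment. -/
def FiniteMean (E : Type*) [NormedAddCommGroup E] [MeasurableSpace E] : Set (Measure E) :=
  {P | IsProbabilityMeasure P ∧ Integrable (fun x : E => x) P}

/-- Distortion functions: functions of bounded variation on `[0,1]` vanishing at `0`.
Only the values on `[0,1]` are ever used. -/
def DistortionFunctions : Set (ℝ → ℝ) :=
  {h | BoundedVariationOn h (Icc 0 1) ∧ h 0 = 0}

/-- The concave envelope `h*` of `h` on `[0,1]`: the pointwise infimum of the concave distortion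
functions dominating `h` on `[0,1]`. -/
def concaveEnvelope (h : ℝ → ℝ) (t : ℝ) : ℝ :=
  sInf {y | ∃ g ∈ DistortionFunctions,
    (∀ s ∈ Icc (0 : ℝ) 1, h s ≤ g s) ∧ ConcaveOn ℝ (Icc 0 1) g ∧ y = g t}

/-- The integrand of the distortion riskmetric of `F`: `h(F(x,∞))` for `x > 0`, and
`h(F(x,∞)) - h(1)` for `x ≤ 0`. -/
def distortionIntegrand (h : ℝ → ℝ) (F : Measure ℝ) (x : ℝ) : ℝ :=
  if 0 < x then h (F.real (Ioi x)) else h (F.real (Ioi x)) - h 1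

/-- The distortion riskmetric `ρ_h` of a random variable with distribution `F`,
`∫_0^∞ h(F(x,∞)) dx + ∫_{-∞}^0 (h(F(x,∞)) - h(1)) dx`,
as an extended real number: integral of the positive part minus integral of the negative part.
When both are infinite, `ρ_h` is undefined and the value here is `⊤ - ⊤ = ⊥`, so that such an `F`
does not contribute to a supremum. -/
def distortionRiskmetric (h : ℝ → ℝ) (F : Measure ℝ) : EReal :=
  ((∫⁻ x, ENNReal.ofReal (distortionIntegrand h F x) : ENNReal) : EReal)
    - ((∫⁻ x, ENNReal.ofReal (-distortionIntegrand h F x) : ENNReal) : EReal)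

/-- The left-quantile function of a distribution `F` on `ℝ` (at levels in `(0,1)`; the values at
`0` and `1`, which may be infinite in the literature, are irrelevant below). -/
def leftQuantile (F : Measure ℝ) (α : ℝ) : ℝ :=
  sInf {x | α ≤ cdf F x}

/-- The `C`-concentration of `F`: the distribution of
`F⁻¹(U) 1_{U ∉ C} + E[F⁻¹(U) | U ∈ C] 1_{U ∈ C}` for `U` uniform on `[0,1]`. -/
def concentration (F : Measure ℝ) (C : Set ℝ) : Measure ℝ :=
  (volume.restrict (Icc (0 : ℝ) 1)).map fun u =>
    Cᶜ.indicator (leftQuantile F) u + C.indicator (fun _ => ⨍ v in C, leftQuantile F v) u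

/-- A set of distributions on `ℝ` is closed under concentration if it contains, with `F`, the
`C`-concentration of `F` for every interval `C ⊆ [0,1]` (open, closed or half-open). -/
def ClosedUnderConcentration (M : Set (Measure ℝ)) : Prop :=
  ∀ F ∈ M, ∀ C : Set ℝ, C.OrdConnected → C ⊆ Icc 0 1 → concentration F C ∈ M

/-- The worst-case objective `sup_{F_X ∈ M} sup_{k ∈ K} ρ_k(f(a,X))` of the action `a`. -/
def worstCase {d n : ℕ} (f : EuclideanSpace ℝ (Fin d) → EuclideanSpace ℝ (Fin n) → ℝ)
    (M : Set (Measure (EuclideanSpace ℝ (Fin n)))) (K : Set (ℝ → ℝ))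
    (a : EuclideanSpace ℝ (Fin d)) : EReal :=
  ⨆ P ∈ M, ⨆ k ∈ K, distortionRiskmetric k (P.map (f a))

end

/-! For a fixed action the suprema over distributions and over `h` commute, so it suffices to show,
for a single `h` and a set `N` closed under concentration, that ρ_h and ρ_{h*} have the same
supremum over `N`. As h ≤ h* and h*(1) = h(1), one inequality is monotonicity.

For the other, let g be the concave hull of (0, 0), (1, h(1)) and finitely many points of the graph
of h. It is piecewise affine, with knots in a finite set Q on which g = h, so ρ_g(F) depends on F
only through the integrals of F⁻¹ over (1 - p, 1), p ∈ Q ∪ {1}. Concentrating F on all intervals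
between consecutive points of {0, 1} ∪ (1 - Q) preserves these integrals and gives F' ∈ N whose
survival function takes values only in {0, 1} ∪ Q, where h = g. Hence ρ_g(F) = ρ_g(F') = ρ_h(F');
this is `exists_mem_distortionRiskmetric_eq_knotFunction`.

Along a dense sequence in the graph of h the hulls increase to a concave L ≥ h
(`exists_knotFunction_tendsto_hull`). Concavity makes L of bounded variation, so h* ≤ L, and
monotone convergence (`distortionRiskmetric_le_of_tendsto`) bounds ρ_{h*}(F) ≤ ρ_L(F) by the
supremum of ρ_h over `N`. -/

/-! ### A linear complementarity problem -/

/-- These are the first-order conditions for minimising the quadratic form cᵀAc - 2b·c over c ≥ 0.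
Varying one coordinate at a time is enough, so definiteness of A plays no role. -/
theorem exists_complementary_solution {ι : Type*} [Fintype ι] (A : ι → ι → ℝ)
    (hsymm : ∀ i j, A i j = A j i) (hnn : ∀ i j, 0 ≤ A i j) (hdiag : ∀ i, 0 < A i i) (b : ι → ℝ) :
    ∃ c : ι → ℝ, (∀ i, 0 ≤ c i) ∧ (∀ i, b i ≤ ∑ j, A i j * c j) ∧
      ∀ i, c i ≠ 0 → ∑ j, A i j * c j = b i := by
  classical
  -- The box makes the domain compact. Its side is chosen so that A i i * R i exceeds |b i|: the
  -- gradient is then positive on the upper faces, which are never active constraints.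
  set R : ι → ℝ := fun i => |b i| / A i i + 1 with hR
  have hRpos : ∀ i, 0 < R i := fun i => by have := hdiag i; positivity
  set E : (ι → ℝ) → ℝ := fun c => (∑ i, ∑ j, A i j * c i * c j) - 2 * ∑ i, b i * c i with hE
  have hcont : Continuous E := by fun_prop
  obtain ⟨c, hcK, hmin⟩ := (isCompact_univ_pi (fun i => isCompact_Icc (a := (0 : ℝ)) (b := R i))).exists_isMinOn
    ⟨fun _ => 0, fun i _ => ⟨le_rfl, (hRpos i).le⟩⟩ hcont.continuousOn
  have hc : ∀ i, 0 ≤ c i ∧ c i ≤ R i := fun i => hcK i (mem_univ i)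
  set w : ι → ℝ := fun i => ∑ j, A i j * c j - b i with hw
  have hvar : ∀ i t, E (c + t • Pi.single i 1) = E c + t * (2 * w i + t * A i i) := by
    intro i t
    have h1 : ∀ k l, A k l * (c + t • Pi.single i 1 : ι → ℝ) k * (c + t • Pi.single i 1 : ι → ℝ) l
        = A k l * c k * c l + (if k = i then t * (A k l * c l) else 0)
          + (if l = i then t * (A k l * c k) else 0)
          + (if k = i then (if l = i then t * t * A k l else 0) else 0) := by
      intro k l
      simp only [Pi.add_apply, Pi.smul_apply, Pi.single_apply, smul_eq_mul]
      split_ifs <;> ring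
    have h2 : ∀ k, b k * (c + t • Pi.single i 1 : ι → ℝ) k = b k * c k + if k = i then t * b k else 0 := by
      intro k
      simp only [Pi.add_apply, Pi.smul_apply, Pi.single_apply, smul_eq_mul]
      split_ifs <;> ring
    simp only [hE, h1, h2, Finset.sum_add_distrib, hw]
    have h3 : ∑ k, ∑ l, (if k = i then t * (A k l * c l) else 0) = t * ∑ j, A i j * c j := by
      rw [Finset.sum_comm]; simp [Finset.mul_sum]
    have h4 : ∑ k, ∑ l, (if l = i then t * (A k l * c k) else 0) = t * ∑ j, A i j * c j := by
      simp [Finset.mul_sum, hsymm _ i]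
    have h5 : ∑ k, ∑ l, (if k = i then (if l = i then t * t * A k l else 0) else 0)
        = t * t * A i i := by
      rw [Finset.sum_comm]; simp
    rw [h3, h4, h5]
    simp
    ring
  have hmem : ∀ i t, 0 ≤ c i + t → c i + t ≤ R i → 0 ≤ t * (2 * w i + t * A i i) := by
    intro i t h0 h1
    have : c + t • Pi.single i 1 ∈ univ.pi fun i => Icc 0 (R i) := by
      intro k _
      by_cases hk : k = i
      · subst hk; simpa using ⟨h0, h1⟩
      · simpa [Pi.single_apply, hk] using hc k
    have := hmin this
    simp only [mem_ofPred_eq, hvar] at this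
    linarith
  have hwtop : ∀ i, c i = R i → 0 < w i := by
    intro i hi
    have h1 : A i i * c i ≤ ∑ j, A i j * c j :=
      Finset.single_le_sum (f := fun j => A i j * c j)
        (fun j _ => mul_nonneg (hnn i j) (hc j).1) (Finset.mem_univ i)
    have h2 : A i i * c i = |b i| + A i i := by
      rw [hi, hR]; have := (hdiag i).ne'; field_simp
    have := le_abs_self (b i)
    have := hdiag i
    simp only [hw]; linarith
  have hwnn : ∀ i, 0 ≤ w i := by
    intro i
    by_contra! hneg
    have hlt : c i < R i := lt_of_le_of_ne (hc i).2 fun h => absurd (hwtop i h) (by linarith)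
    -- A step that stays in the box and is short enough for the linear term 2 * w i to dominate t *
    -- A i i, so the energy would drop.
    set t := min (R i - c i) (-w i / A i i) with ht
    have htpos : 0 < t := lt_min (by linarith) (div_pos (by linarith) (hdiag i))
    have h1 : t * A i i ≤ -w i := by
      rw [← le_div_iff₀ (hdiag i)]; exact min_le_right _ _
    have h2 := hmem i t (by linarith [(hc i).1]) (by linarith [min_le_left (R i - c i) (-w i / A i i)])
    nlinarith
  refine ⟨c, fun i => (hc i).1, fun i => by have := hwnn i; simp only [hw] at this; linarith, ?_⟩
  intro i hi
  by_contra hne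
  have hwpos : 0 < w i := lt_of_le_of_ne (hwnn i) fun h => hne (by simp only [hw] at h; linarith)
  have hcpos : 0 < c i := lt_of_le_of_ne (hc i).1 (Ne.symm hi)
  set t := min (c i) (w i / A i i) with ht
  have htpos : 0 < t := lt_min hcpos (div_pos hwpos (hdiag i))
  have h1 : t * A i i ≤ w i := by
    rw [← le_div_iff₀ (hdiag i)]; exact min_le_right _ _
  have h2 := hmem i (-t) (by linarith [min_le_left (c i) (w i / A i i)]) (by linarith [(hc i).2])
  nlinarith

/-! ### Piecewise affine concave hulls of finitely many points -/

/-- The continuous function on `[0,1]` with values `0` at `0` and `m` at `1` that is affine between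
the points of `Q` and whose slope drops by `c p` at `p ∈ Q`. -/
def knotFunction (Q : Finset ℝ) (c : ℝ → ℝ) (m t : ℝ) : ℝ :=
  m * t + ∑ p ∈ Q, c p * (min t p - p * t)

theorem knotFunction_zero {Q : Finset ℝ} (hQ : ∀ p ∈ Q, p ∈ Ioo (0 : ℝ) 1) (c : ℝ → ℝ) (m : ℝ) :
    knotFunction Q c m 0 = 0 := by
  rw [knotFunction, Finset.sum_eq_zero]
  · simp
  · intro p hp; rw [min_eq_left (hQ p hp).1.le]; ring

theorem knotFunction_one {Q : Finset ℝ} (hQ : ∀ p ∈ Q, p ∈ Ioo (0 : ℝ) 1) (c : ℝ → ℝ) (m : ℝ) :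
    knotFunction Q c m 1 = m := by
  rw [knotFunction, Finset.sum_eq_zero]
  · simp
  · intro p hp; rw [min_eq_right (hQ p hp).2.le]; ring

theorem continuous_knotFunction (Q : Finset ℝ) (c : ℝ → ℝ) (m : ℝ) :
    Continuous (knotFunction Q c m) := by
  unfold knotFunction; fun_prop

theorem concaveOn_knotFunction {Q : Finset ℝ} {c : ℝ → ℝ} (hc : ∀ p ∈ Q, 0 ≤ c p) (m : ℝ) :
    ConcaveOn ℝ (Icc 0 1) (knotFunction Q c m) := by
  refine ⟨convex_Icc 0 1, fun x _ y _ a b ha hb _ => ?_⟩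
  simp only [knotFunction, smul_eq_mul]
  rw [mul_add, mul_add, Finset.mul_sum, Finset.mul_sum, add_add_add_comm, ← Finset.sum_add_distrib]
  refine add_le_add (by linarith) (Finset.sum_le_sum fun p hp => ?_)
  have hab : a * min x p + b * min y p ≤ min (a * x + b * y) p := by
    refine le_min (add_le_add (by gcongr; exact min_le_left _ _) (by gcongr; exact min_le_left _ _)) ?_
    calc _ ≤ a * p + b * p := by gcongr <;> exact min_le_right _ _
      _ = p := by rw [← add_mul]; simp [*]
  have := mul_le_mul_of_nonneg_left hab (hc p hp)
  linarith

/-- Between neighbouring points of Q ∪ {0, 1} the left side is affine, so concavity of `f` carries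
the comparison from the two endpoints to the whole interval. -/
theorem knotFunction_le_of_concaveOn {Q : Finset ℝ} (hQ : ∀ p ∈ Q, p ∈ Ioo (0 : ℝ) 1) {c : ℝ → ℝ}
    {m : ℝ} {f : ℝ → ℝ} (hf : ConcaveOn ℝ (Icc 0 1) f) (h0 : 0 ≤ f 0) (h1 : m ≤ f 1)
    (hfQ : ∀ p ∈ Q, knotFunction Q c m p ≤ f p) {t : ℝ} (ht : t ∈ Icc (0 : ℝ) 1) :
    knotFunction Q c m t ≤ f t := by
  classical
  have hmem : ∀ x ∈ insert 0 (insert 1 Q), x ∈ Icc (0 : ℝ) 1 ∧ knotFunction Q c m x ≤ f x := by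
    intro x hx
    simp only [Finset.mem_insert] at hx
    rcases hx with rfl | rfl | hx
    · exact ⟨by simp, by rwa [knotFunction_zero hQ]⟩
    · exact ⟨by simp, by rwa [knotFunction_one hQ]⟩
    · exact ⟨Ioo_subset_Icc_self (hQ x hx), hfQ x hx⟩
  obtain ⟨a, ha, hamax⟩ := ((insert 0 (insert 1 Q)).filter (· ≤ t)).exists_max_image id
    ⟨0, by simp [ht.1]⟩
  obtain ⟨b, hb, hbmin⟩ := ((insert 0 (insert 1 Q)).filter (t ≤ ·)).exists_min_image id
    ⟨1, by simp [ht.2]⟩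
  rw [Finset.mem_filter] at ha hb
  obtain ⟨haQ, hat⟩ := ha
  obtain ⟨hbQ, htb⟩ := hb
  rcases hat.eq_or_lt with rfl | hat'
  · exact (hmem _ haQ).2
  have hgap : ∀ p ∈ Q, p ≤ a ∨ b ≤ p := by
    intro p hp
    rcases le_total p t with h | h
    · exact Or.inl (hamax p (by simp [hp, h]))
    · exact Or.inr (hbmin p (by simp [hp, h]))
  set r := (t - a) / (b - a) with hr
  have hba : 0 < b - a := by linarith
  have hr0 : 0 ≤ r := div_nonneg (by linarith) hba.le
  have hr1 : 0 ≤ 1 - r := by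
    rw [sub_nonneg, hr, div_le_one hba]; linarith
  have htr : t = (1 - r) * a + r * b := by
    rw [hr]; field_simp; ring
  have haff : knotFunction Q c m t = (1 - r) * knotFunction Q c m a + r * knotFunction Q c m b := by
    have : ∀ p ∈ Q, c p * (min t p - p * t) =
        (1 - r) * (c p * (min a p - p * a)) + r * (c p * (min b p - p * b)) := by
      intro p hp
      rcases hgap p hp with h | h
      · rw [min_eq_right h, min_eq_right (h.trans hat), min_eq_right (h.trans (hat.trans htb)), htr]
        ring
      · rw [min_eq_left h, min_eq_left (htb.trans h), min_eq_left ((hat.trans htb).trans h), htr]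
        ring
    simp only [knotFunction]
    rw [Finset.sum_congr rfl this, Finset.sum_add_distrib, ← Finset.mul_sum, ← Finset.mul_sum, htr]
    ring
  have hconc := hf.2 (hmem a haQ).1 (hmem b hbQ).1 hr1 hr0 (by ring)
  simp only [smul_eq_mul] at hconc
  rw [← htr] at hconc
  rw [haff]
  have := mul_le_mul_of_nonneg_left (hmem a haQ).2 hr1
  have := mul_le_mul_of_nonneg_left (hmem b hbQ).2 hr0
  linarith

/-- An obstacle problem: min(s, t) - s * t is the Green function of -d²/dt² on [0,1] with zero
boundary values, and complementarity says that the slope drops only where the hull touches h. -/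
theorem exists_knotFunction_hull (h : ℝ → ℝ) {P : Finset ℝ} (hP : ∀ p ∈ P, p ∈ Ioo (0 : ℝ) 1) :
    ∃ Q ⊆ P, ∃ c : ℝ → ℝ, (∀ p ∈ Q, 0 ≤ c p) ∧ (∀ p ∈ Q, knotFunction Q c (h 1) p = h p) ∧
      ∀ p ∈ P, h p ≤ knotFunction Q c (h 1) p := by
  classical
  obtain ⟨c, hc0, hcb, hcs⟩ := exists_complementary_solution (ι := P)
    (fun i j => min (i : ℝ) j - j * i) (fun i j => by simp only [min_comm, mul_comm])
    (fun i j => by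
      have hi := hP i i.2
      have hj := hP j j.2
      rcases le_total (i : ℝ) j with hij | hij
      · rw [min_eq_left hij]; nlinarith [hi.1, hj.2]
      · rw [min_eq_right hij]; nlinarith [hi.2, hj.1])
    (fun i => by have hi := hP i i.2; simp only [min_self]; nlinarith [hi.1, hi.2])
    (fun i => h i - h 1 * i)
  set c' : ℝ → ℝ := fun p => if hp : p ∈ P then c ⟨p, hp⟩ else 0 with hc'
  have hsum : ∀ t, knotFunction (P.filter fun p => c' p ≠ 0) c' (h 1) t
      = h 1 * t + ∑ j : P, (min t (j : ℝ) - j * t) * c j := by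
    intro t
    rw [knotFunction, Finset.sum_filter_of_ne, ← Finset.sum_coe_sort]
    · congr 1
      refine Finset.sum_congr rfl fun p _ => ?_
      simp [hc', mul_comm]
    · intro p _ hne hcp; exact hne (by rw [hcp, zero_mul])
  refine ⟨P.filter fun p => c' p ≠ 0, Finset.filter_subset _ _, c', ?_, ?_, ?_⟩
  · intro p hp
    have hpP := (Finset.mem_filter.1 hp).1
    simp only [hc', hpP, dif_pos]; exact hc0 _
  · intro p hp
    have hpP := (Finset.mem_filter.1 hp).1
    have hne := (Finset.mem_filter.1 hp).2
    simp only [hc', hpP, dif_pos] at hne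
    rw [hsum]
    have := hcs ⟨p, hpP⟩ hne
    simp only at this
    linarith
  · intro p hpP
    rw [hsum]
    have := hcb ⟨p, hpP⟩
    simp only at this
    linarith

/-! ### Concave functions on a compact interval have bounded variation -/

open Filter Topology in
theorem eVariationOn_le_add_of_edist_le {f u v : ℝ → ℝ} {s : Set ℝ}
    (h : ∀ x ∈ s, ∀ y ∈ s, edist (f x) (f y) ≤ edist (u x) (u y) + edist (v x) (v y)) :
    eVariationOn f s ≤ eVariationOn u s + eVariationOn v s := by
  refine iSup_le fun p => ?_
  calc _ ≤ ∑ i ∈ Finset.range p.1, (edist (u (p.2.1 (i + 1))) (u (p.2.1 i))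
        + edist (v (p.2.1 (i + 1))) (v (p.2.1 i))) :=
        Finset.sum_le_sum fun i _ => h _ (p.2.2.2 _) _ (p.2.2.2 _)
    _ ≤ _ := by
      rw [Finset.sum_add_distrib]
      exact add_le_add (le_iSup_of_le p le_rfl) (le_iSup_of_le p le_rfl)

theorem MonotoneOn.boundedVariationOn_Icc {f : ℝ → ℝ} {a b : ℝ} (hf : MonotoneOn f (Icc a b))
    (hab : a ≤ b) : BoundedVariationOn f (Icc a b) := by
  have h := hf.eVariationOn_eq (left_mem_Icc.2 hab) (right_mem_Icc.2 hab)
  rw [inter_self] at h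
  rw [BoundedVariationOn, h]
  exact ENNReal.ofReal_ne_top

theorem AntitoneOn.boundedVariationOn_Icc {f : ℝ → ℝ} {a b : ℝ} (hf : AntitoneOn f (Icc a b))
    (hab : a ≤ b) : BoundedVariationOn f (Icc a b) := by
  -- Taking -f twice loses a factor two, which is harmless since only finiteness is at stake.
  have h := eVariationOn_le_add_of_edist_le (f := f) (u := -f) (v := -f) (s := Icc a b)
    fun x _ y _ => by simp
  exact ne_top_of_le_ne_top (ENNReal.add_ne_top.2
    ⟨hf.neg.boundedVariationOn_Icc hab, hf.neg.boundedVariationOn_Icc hab⟩) h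

theorem ConcaveOn.exists_supergradient {f : ℝ → ℝ} {S : Set ℝ} (hf : ConcaveOn ℝ S f) {c : ℝ}
    (hc : c ∈ interior S) : ∃ s : ℝ, ∀ x ∈ S, f x - s * x ≤ f c - s * c := by
  have hg := hf.neg
  refine ⟨-derivWithin (-f) (Ioi c) c, fun x hx => ?_⟩
  rcases lt_trichotomy c x with h | rfl | h
  · have := hg.rightDeriv_le_slope_of_mem_interior hc hx h
    rw [slope_def_field, le_div_iff₀ (by linarith)] at this
    simp only [Pi.neg_apply] at this
    linarith
  · exact le_rfl
  · have := (hg.slope_le_leftDeriv_of_mem_interior hx hc h).trans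
      (hg.leftDeriv_le_rightDeriv_of_mem_interior hc)
    rw [slope_def_field, div_le_iff₀ (by linarith)] at this
    simp only [Pi.neg_apply] at this
    linarith

theorem ConcaveOn.monotoneOn_of_isMaxOn {f : ℝ → ℝ} {a b c : ℝ} (hf : ConcaveOn ℝ (Icc a b) f)
    (hc : c ∈ Icc a b) (hmax : ∀ x ∈ Icc a b, f x ≤ f c) : MonotoneOn f (Icc a c) := by
  intro x hx y hy hxy
  have hx' : x ∈ Icc a b := ⟨hx.1, hx.2.trans hc.2⟩
  have := hf.min_le_of_mem_segment hx' hc (by rw [segment_eq_Icc hx.2]; exact ⟨hxy, hy.2⟩)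
  rwa [min_eq_left (hmax x hx')] at this

theorem ConcaveOn.antitoneOn_of_isMaxOn {f : ℝ → ℝ} {a b c : ℝ} (hf : ConcaveOn ℝ (Icc a b) f)
    (hc : c ∈ Icc a b) (hmax : ∀ x ∈ Icc a b, f x ≤ f c) : AntitoneOn f (Icc c b) := by
  intro x hx y hy hxy
  have hy' : y ∈ Icc a b := ⟨hc.1.trans hy.1, hy.2⟩
  have := hf.min_le_of_mem_segment hc hy' (by rw [segment_eq_Icc hy.1]; exact ⟨hx.1, hxy⟩)
  rwa [min_eq_right (hmax y hy')] at this

/-- Subtracting a supergradient line at the midpoint moves the maximum there, so the remainder is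
monotone on the left half and antitone on the right half. -/
theorem ConcaveOn.boundedVariationOn_Icc {f : ℝ → ℝ} {a b : ℝ} (hf : ConcaveOn ℝ (Icc a b) f)
    (hab : a < b) : BoundedVariationOn f (Icc a b) := by
  have hc : (a + b) / 2 ∈ Ioo a b := ⟨by linarith, by linarith⟩
  have hcI := Ioo_subset_Icc_self hc
  obtain ⟨s, hs⟩ := hf.exists_supergradient (by rwa [interior_Icc])
  set c := (a + b) / 2
  have hg : ConcaveOn ℝ (Icc a b) fun x => f x - s * x := by
    refine hf.sub ⟨convex_Icc a b, fun x _ y _ p q _ _ _ => ?_⟩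
    simp only [smul_eq_mul]; linarith
  have h1 := (hg.monotoneOn_of_isMaxOn hcI hs).boundedVariationOn_Icc hcI.1
  have h2 := (hg.antitoneOn_of_isMaxOn hcI hs).boundedVariationOn_Icc hcI.2
  have h3 : eVariationOn (fun x => f x - s * x) (Icc a b) ≠ ⊤ := by
    rw [← Icc_union_Icc_eq_Icc hcI.1 hcI.2,
      eVariationOn.union _ (isGreatest_Icc hcI.1) (isLeast_Icc hcI.2)]
    exact ENNReal.add_ne_top.2 ⟨h1, h2⟩
  -- The slope |s| replaces s to make the line monotone; the increments have the same absolute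
  -- value.
  have h4 : eVariationOn (fun x => |s| * x) (Icc a b) ≠ ⊤ :=
    MonotoneOn.boundedVariationOn_Icc
      (fun x _ y _ hxy => mul_le_mul_of_nonneg_left hxy (abs_nonneg s)) hab.le
  refine ne_top_of_le_ne_top (ENNReal.add_ne_top.2 ⟨h3, h4⟩)
    (eVariationOn_le_add_of_edist_le fun x _ y _ => ?_)
  rw [edist_dist, edist_dist, edist_dist, ← ENNReal.ofReal_add dist_nonneg dist_nonneg]
  refine ENNReal.ofReal_le_ofReal ?_
  rw [Real.dist_eq, Real.dist_eq, Real.dist_eq, ← mul_sub, abs_mul, abs_abs, ← abs_mul]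
  calc _ = |(f x - s * x - (f y - s * y)) + s * (x - y)| := by ring_nf
    _ ≤ _ := abs_add_le _ _

/-! ### A concave majorant as an increasing limit of finite hulls -/

open Filter Topology in
theorem exists_knotFunction_tendsto_hull {h : ℝ → ℝ} (h0 : h 0 = 0) {B : ℝ}
    (hB : ∀ t ∈ Icc (0 : ℝ) 1, h t ≤ B) :
    ∃ (Q : ℕ → Finset ℝ) (c : ℕ → ℝ → ℝ) (L : ℝ → ℝ),
      (∀ n, ∀ p ∈ Q n, p ∈ Ioo (0 : ℝ) 1) ∧
      (∀ n, ∀ p ∈ Q n, knotFunction (Q n) (c n) (h 1) p = h p) ∧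
      (∀ t ∈ Icc (0 : ℝ) 1, Monotone fun n => knotFunction (Q n) (c n) (h 1) t) ∧
      (∀ t ∈ Icc (0 : ℝ) 1,
        Tendsto (fun n => knotFunction (Q n) (c n) (h 1) t) atTop (𝓝 (L t))) ∧
      L ∈ DistortionFunctions ∧ ConcaveOn ℝ (Icc 0 1) L ∧ ∀ t ∈ Icc (0 : ℝ) 1, h t ≤ L t := by
  classical
  -- The sequence is dense in the graph of h, not merely in (0,1), because h may jump.
  set Γ : Set (ℝ × ℝ) := (fun t => (t, h t)) '' Ioo 0 1 with hΓ
  have : Nonempty Γ := ⟨⟨_, 1 / 2, by norm_num, rfl⟩⟩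
  set d := TopologicalSpace.denseSeq Γ with hd
  have hdd : DenseRange d := TopologicalSpace.denseRange_denseSeq Γ
  have hdI : ∀ k, (d k).1.1 ∈ Ioo (0 : ℝ) 1 ∧ (d k).1.2 = h (d k).1.1 := by
    intro k
    obtain ⟨t, ht, hk⟩ := (d k).2
    rw [← hk]
    exact ⟨ht, rfl⟩
  set P : ℕ → Finset ℝ := fun n => (Finset.range (n + 1)).image fun k => (d k).1.1 with hP
  have hPI : ∀ n, ∀ p ∈ P n, p ∈ Ioo (0 : ℝ) 1 := by
    intro n p hp
    obtain ⟨k, _, rfl⟩ := Finset.mem_image.1 hp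
    exact (hdI k).1
  have hPmono : ∀ n, P n ⊆ P (n + 1) := fun n =>
    Finset.image_subset_image (Finset.range_subset_range.2 (by omega))
  choose Q hQP c hc hQ hPle using fun n => exists_knotFunction_hull h (hPI n)
  have hQI : ∀ n, ∀ p ∈ Q n, p ∈ Ioo (0 : ℝ) 1 := fun n p hp => hPI n p (hQP n hp)
  set g : ℕ → ℝ → ℝ := fun n => knotFunction (Q n) (c n) (h 1) with hg
  have hgc : ∀ n, ConcaveOn ℝ (Icc 0 1) (g n) := fun n => concaveOn_knotFunction (hc n) _
  have hmono : ∀ t ∈ Icc (0 : ℝ) 1, Monotone fun n => g n t := by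
    intro t ht
    refine monotone_nat_of_le_succ fun n => ?_
    refine knotFunction_le_of_concaveOn (hQI n) (hgc (n + 1)) (knotFunction_zero (hQI _) _ _).ge
      (knotFunction_one (hQI _) _ _).ge (fun p hp => ?_) ht
    rw [hQ n p hp]
    exact hPle _ p (hPmono n (hQP n hp))
  have hbd : ∀ t ∈ Icc (0 : ℝ) 1, ∀ n, g n t ≤ B := fun t ht n =>
    knotFunction_le_of_concaveOn (hQI n) (f := fun _ => B) (concaveOn_const B (convex_Icc 0 1))
      (by simpa [h0] using hB 0 (by simp)) (hB 1 (by simp))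
      (fun p hp => by rw [hQ n p hp]; exact hB p (Ioo_subset_Icc_self (hQI n p hp))) ht
  set L : ℝ → ℝ := fun t => ⨆ n, g n t with hL
  have htend : ∀ t ∈ Icc (0 : ℝ) 1, Tendsto (fun n => g n t) atTop (𝓝 (L t)) := fun t ht =>
    tendsto_atTop_ciSup (hmono t ht) ⟨B, by rintro _ ⟨n, rfl⟩; exact hbd t ht n⟩
  have hLle : ∀ t ∈ Icc (0 : ℝ) 1, ∀ n, g n t ≤ L t := fun t ht n =>
    (hmono t ht).ge_of_tendsto (htend t ht) n
  have hLc : ConcaveOn ℝ (Icc 0 1) L := by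
    refine ⟨convex_Icc 0 1, fun x hx y hy a b ha hb hab => ?_⟩
    exact le_of_tendsto_of_tendsto'
      (((htend x hx).const_smul a).add ((htend y hy).const_smul b))
      (htend _ (convex_Icc (0 : ℝ) 1 hx hy ha hb hab))
      fun n => (hgc n).2 hx hy ha hb hab
  have hL0 : L 0 = 0 := by simp only [hL, hg, knotFunction_zero (hQI _), ciSup_const]
  have hL1 : L 1 = h 1 := by simp only [hL, hg, knotFunction_one (hQI _), ciSup_const]
  refine ⟨Q, c, L, hQI, hQ, hmono, htend, ⟨hLc.boundedVariationOn_Icc one_pos, hL0⟩, hLc, ?_⟩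
  intro t ht
  rcases ht.1.eq_or_lt with rfl | ht0
  · rw [hL0, h0]
  rcases ht.2.eq_or_lt with rfl | ht1
  · rw [hL1]
  by_contra! hlt
  have hcont : ContinuousAt L t := by
    have := hLc.continuousOn_interior
    rw [interior_Icc] at this
    exact this.continuousAt (Ioo_mem_nhds ht0 ht1)
  -- As L is continuous inside (0,1), L < h is a relatively open condition on the graph; it would
  -- hold at some point of the dense sequence, where L ≥ h is known.
  have hnhds : {z : Γ | L z.1.1 < z.1.2} ∈ 𝓝 (⟨(t, h t), t, ⟨ht0, ht1⟩, rfl⟩ : Γ) := by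
    have h1 : ContinuousAt (fun z : Γ => L z.1.1) ⟨(t, h t), t, ⟨ht0, ht1⟩, rfl⟩ :=
      ContinuousAt.comp (g := L) (f := fun z : Γ => z.1.1) hcont (by fun_prop)
    exact h1.eventually_lt (by fun_prop) hlt
  obtain ⟨k, hz⟩ := hdd.exists_mem_open isOpen_interior ⟨_, mem_interior_iff_mem_nhds.2 hnhds⟩
  replace hz := interior_subset hz
  have hk : h (d k).1.1 ≤ L (d k).1.1 :=
    (hPle k _ (Finset.mem_image_of_mem _ (Finset.self_mem_range_succ k))).trans
      (hLle _ (Ioo_subset_Icc_self (hdI k).1) k)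
  rw [mem_ofPred_eq, (hdI k).2] at hz
  exact absurd hz (not_lt.2 hk)

theorem exists_forall_le_of_mem_distortionFunctions {h : ℝ → ℝ} (hh : h ∈ DistortionFunctions) :
    ∃ B, ∀ t ∈ Icc (0 : ℝ) 1, h t ≤ B :=
  ⟨h 0 + (eVariationOn h (Icc 0 1)).toReal, fun t ht => by
    have := hh.1.sub_le ht (left_mem_Icc.2 zero_le_one); linarith⟩

theorem concaveEnvelope_le {h g : ℝ → ℝ} (hg : g ∈ DistortionFunctions)
    (hgc : ConcaveOn ℝ (Icc 0 1) g) (hhg : ∀ s ∈ Icc (0 : ℝ) 1, h s ≤ g s) {t : ℝ}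
    (ht : t ∈ Icc (0 : ℝ) 1) : concaveEnvelope h t ≤ g t :=
  csInf_le ⟨h t, by rintro _ ⟨g', _, hg', _, rfl⟩; exact hg' t ht⟩ ⟨g, hg, hhg, hgc, rfl⟩

theorem le_concaveEnvelope {h g : ℝ → ℝ} (hg : g ∈ DistortionFunctions)
    (hgc : ConcaveOn ℝ (Icc 0 1) g) (hhg : ∀ s ∈ Icc (0 : ℝ) 1, h s ≤ g s) {t : ℝ}
    (ht : t ∈ Icc (0 : ℝ) 1) : h t ≤ concaveEnvelope h t :=
  le_csInf ⟨_, g, hg, hhg, hgc, rfl⟩ (by rintro _ ⟨g', _, hg', _, rfl⟩; exact hg' t ht)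

/-! ### Left quantiles -/

open Filter Topology in
-- Right-continuity of the cdf makes the defining infimum attained. For u in (0,1) the set is
-- nonempty and bounded below, so the default value of `sInf` does not interfere.
theorem leftQuantile_le_iff (F : Measure ℝ) {u : ℝ} (hu : u ∈ Ioo (0 : ℝ) 1) (x : ℝ) :
    leftQuantile F u ≤ x ↔ u ≤ cdf F x := by
  have hbdd : BddBelow {x | u ≤ cdf F x} := by
    obtain ⟨y, hy⟩ := ((tendsto_cdf_atBot F).eventually_lt_const hu.1).exists
    exact ⟨y, fun z hz => le_of_not_gt fun hzy =>
      absurd (hz.trans (monotone_cdf F hzy.le)) (not_le.2 hy)⟩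
  have hne : {x | u ≤ cdf F x}.Nonempty := by
    obtain ⟨y, hy⟩ := ((tendsto_cdf_atTop F).eventually_const_lt hu.2).exists
    exact ⟨y, hy.le⟩
  refine ⟨fun h => ?_, fun h => csInf_le hbdd h⟩
  have hcont : Tendsto (cdf F) (𝓝[>] x) (𝓝 (cdf F x)) :=
    ((cdf F).right_continuous x).tendsto.mono_left (nhdsWithin_mono _ Ioi_subset_Ici_self)
  refine ge_of_tendsto hcont ?_
  filter_upwards [self_mem_nhdsWithin] with z hz
  obtain ⟨y, hy, hyz⟩ := exists_lt_of_csInf_lt hne (h.trans_lt hz)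
  exact le_trans hy (monotone_cdf F hyz.le)

theorem monotoneOn_leftQuantile (F : Measure ℝ) : MonotoneOn (leftQuantile F) (Ioo 0 1) := by
  intro u hu v hv huv
  rw [leftQuantile_le_iff F hu]
  exact huv.trans ((leftQuantile_le_iff F hv _).1 le_rfl)

theorem exists_lt_leftQuantile_of_lt (F : Measure ℝ) {u : ℝ} (hu : u ∈ Ioo (0 : ℝ) 1) {x : ℝ}
    (hx : x < leftQuantile F u) : ∃ w ∈ Ioo 0 u, x < leftQuantile F w := by
  have h : cdf F x < u := by rwa [← not_le, ← leftQuantile_le_iff F hu, not_le]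
  obtain ⟨w, hw1, hw2⟩ := exists_between h
  have hw0 := (cdf_nonneg F x).trans_lt hw1
  refine ⟨w, ⟨hw0, hw2⟩, ?_⟩
  rwa [← not_le, leftQuantile_le_iff F ⟨hw0, hw2.trans hu.2⟩, not_le]

theorem aemeasurable_of_monotoneOn_Ioo {φ : ℝ → ℝ} (hφ : MonotoneOn φ (Ioo 0 1)) :
    AEMeasurable φ (volume.restrict (Icc (0 : ℝ) 1)) := by
  rw [← Measure.restrict_congr_set (Ioo_ae_eq_Icc (μ := volume) (a := (0 : ℝ)) (b := 1))]
  exact aemeasurable_restrict_of_monotoneOn measurableSet_Ioo hφ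

theorem isProbabilityMeasure_restrict_Icc :
    IsProbabilityMeasure (volume.restrict (Icc (0 : ℝ) 1)) := ⟨by simp⟩

/-- A nondecreasing left-continuous function is the left quantile of its law under the uniform
distribution; `hleft` is the half of left-continuity that monotonicity does not give. -/
theorem leftQuantile_map_of_monotoneOn {φ : ℝ → ℝ} (hφ : MonotoneOn φ (Ioo 0 1))
    (hleft : ∀ u ∈ Ioo (0 : ℝ) 1, ∀ x < φ u, ∃ w ∈ Ioo 0 u, x < φ w) {u : ℝ}
    (hu : u ∈ Ioo (0 : ℝ) 1) :
    leftQuantile ((volume.restrict (Icc (0 : ℝ) 1)).map φ) u = φ u := by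
  have hm := aemeasurable_of_monotoneOn_Ioo hφ
  have := isProbabilityMeasure_restrict_Icc
  have := Measure.isProbabilityMeasure_map hm
  refine eq_of_forall_ge_iff fun x => ?_
  rw [leftQuantile_le_iff _ hu, cdf_eq_real, measureReal_def,
    Measure.map_apply_of_aemeasurable hm measurableSet_Iic,
    ← ENNReal.ofReal_le_iff_le_toReal (measure_ne_top _ _)]
  constructor
  · contrapose!
    intro hx
    obtain ⟨w, hw, hxw⟩ := hleft u hu x hx
    -- Nothing is known about φ outside (0,1), so the null sets {1} and the complement of [0,1] are
    -- added.
    calc _ ≤ (volume.restrict (Icc (0 : ℝ) 1)) (Icc 0 w ∪ {1} ∪ (Icc 0 1)ᶜ) := by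
          refine measure_mono fun v hv => ?_
          by_contra hcon
          rw [mem_union, mem_union, not_or, not_or, notMem_compl_iff, mem_singleton_iff] at hcon
          obtain ⟨⟨hvw, hv1⟩, hv0, hv1'⟩ := hcon
          replace hvw : 0 ≤ v → w < v := fun h => lt_of_not_ge fun h' => hvw ⟨h, h'⟩
          exact absurd ((hxw.trans_le (hφ ⟨hw.1, hw.2.trans hu.2⟩
            ⟨hw.1.trans (hvw hv0), lt_of_le_of_ne hv1' hv1⟩ (hvw hv0).le)).trans_le hv)
            (lt_irrefl _)
      _ ≤ volume.restrict (Icc (0 : ℝ) 1) (Icc 0 w) + volume.restrict (Icc (0 : ℝ) 1) {1}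
          + volume.restrict (Icc (0 : ℝ) 1) (Icc 0 1)ᶜ :=
          (measure_union_le _ _).trans (add_le_add (measure_union_le _ _) le_rfl)
      _ ≤ ENNReal.ofReal w + 0 + 0 := by
          refine add_le_add (add_le_add ?_ (by simp)) ?_
          · refine (Measure.restrict_apply_le _ _).trans ?_
            simp
          · rw [Measure.restrict_apply measurableSet_Icc.compl, compl_inter_self, measure_empty]
      _ < ENNReal.ofReal u := by
          rw [add_zero, add_zero]
          exact (ENNReal.ofReal_lt_ofReal_iff hu.1).2 hw.2
  · intro hx
    calc ENNReal.ofReal u = (volume.restrict (Icc (0 : ℝ) 1)) (Ioc 0 u) := by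
          have hsub : Ioc 0 u ⊆ Icc 0 1 := fun v hv => ⟨hv.1.le, hv.2.trans hu.2.le⟩
          rw [Measure.restrict_apply measurableSet_Ioc, inter_eq_left.2 hsub, Real.volume_Ioc,
            sub_zero]
      _ ≤ _ := measure_mono fun v hv => (hφ ⟨hv.1, hv.2.trans_lt hu.2⟩ hu hv.2).trans hx

theorem map_leftQuantile (F : Measure ℝ) [IsProbabilityMeasure F] :
    (volume.restrict (Icc (0 : ℝ) 1)).map (leftQuantile F) = F := by
  have hmono := monotoneOn_leftQuantile F
  have := isProbabilityMeasure_restrict_Icc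
  have := Measure.isProbabilityMeasure_map (aemeasurable_of_monotoneOn_Ioo hmono)
  refine Measure.eq_of_cdf _ _ (StieltjesFunction.ext fun x => ?_)
  have key : ∀ u ∈ Ioo (0 : ℝ) 1,
      u ≤ cdf ((volume.restrict (Icc (0 : ℝ) 1)).map (leftQuantile F)) x ↔ u ≤ cdf F x := by
    intro u hu
    rw [← leftQuantile_le_iff _ hu, ← leftQuantile_le_iff _ hu, leftQuantile_map_of_monotoneOn
      hmono (fun u hu x hx => exists_lt_leftQuantile_of_lt F hu hx) hu]
  refine le_antisymm (le_of_not_gt fun hlt => ?_) (le_of_not_gt fun hlt => ?_)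
  · obtain ⟨u, h1, h2⟩ := exists_between hlt
    have := (key u ⟨(cdf_nonneg _ _).trans_lt h1, h2.trans_le (cdf_le_one _ _)⟩).1 h2.le
    linarith
  · obtain ⟨u, h1, h2⟩ := exists_between hlt
    have := (key u ⟨(cdf_nonneg _ _).trans_lt h1, h2.trans_le (cdf_le_one _ _)⟩).2 h2.le
    linarith

theorem integrableOn_leftQuantile {F : Measure ℝ} (hF : F ∈ FiniteMean ℝ) :
    IntegrableOn (leftQuantile F) (Icc 0 1) := by
  have := hF.1
  have h := hF.2
  rw [← map_leftQuantile F] at h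
  exact (integrable_map_measure aestronglyMeasurable_id
    (aemeasurable_of_monotoneOn_Ioo (monotoneOn_leftQuantile F))).1 h

/-! ### Concentration on one interval -/

theorem le_setAverage_leftQuantile {F : Measure ℝ} (hF : F ∈ FiniteMean ℝ) {a b : ℝ}
    (ha : 0 ≤ a) (hab : a < b) (hb : b ≤ 1) {u : ℝ} (hu : u ∈ Ioo (0 : ℝ) 1) (hua : u ≤ a) :
    leftQuantile F u ≤ ⨍ v in Ioc a b, leftQuantile F v := by
  have hint : IntegrableOn (leftQuantile F) (Ioo a b) :=
    (integrableOn_leftQuantile hF).mono_set fun v hv => ⟨ha.trans hv.1.le, hv.2.le.trans hb⟩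
  rw [setAverage_congr Ioo_ae_eq_Ioc.symm, setAverage_eq, smul_eq_mul, Real.volume_real_Ioo_of_le hab.le,
    ← div_eq_inv_mul, le_div_iff₀ (by linarith)]
  have := setIntegral_mono_on (f := fun _ => leftQuantile F u) (integrableOn_const (by simp)) hint
    measurableSet_Ioo fun v hv => monotoneOn_leftQuantile F hu
      ⟨hu.1.trans_le (hua.trans hv.1.le), hv.2.trans_le hb⟩ (hua.trans hv.1.le)
  rwa [setIntegral_const, Real.volume_real_Ioo_of_le hab.le, smul_eq_mul, mul_comm] at this

theorem setAverage_leftQuantile_le {F : Measure ℝ} (hF : F ∈ FiniteMean ℝ) {a b : ℝ}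
    (ha : 0 ≤ a) (hab : a < b) (hb : b ≤ 1) {u : ℝ} (hu : u ∈ Ioo (0 : ℝ) 1) (hub : b ≤ u) :
    ⨍ v in Ioc a b, leftQuantile F v ≤ leftQuantile F u := by
  have hint : IntegrableOn (leftQuantile F) (Ioo a b) :=
    (integrableOn_leftQuantile hF).mono_set fun v hv => ⟨ha.trans hv.1.le, hv.2.le.trans hb⟩
  rw [setAverage_congr Ioo_ae_eq_Ioc.symm, setAverage_eq, smul_eq_mul, Real.volume_real_Ioo_of_le hab.le,
    ← div_eq_inv_mul, div_le_iff₀ (by linarith)]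
  have := setIntegral_mono_on (g := fun _ => leftQuantile F u) hint (integrableOn_const (by simp))
    measurableSet_Ioo fun v hv => monotoneOn_leftQuantile F
      ⟨ha.trans_lt hv.1, hv.2.trans_le hb⟩ hu (hv.2.le.trans hub)
  rwa [setIntegral_const, Real.volume_real_Ioo_of_le hab.le, smul_eq_mul, mul_comm] at this

/-- The average lies between the quantile values on both sides, so monotonicity survives; the
interval is open on the left and closed on the right so that left-continuity survives too. -/
theorem leftQuantile_concentration_Ioc {F : Measure ℝ} (hF : F ∈ FiniteMean ℝ) {a b : ℝ}
    (ha : 0 ≤ a) (hab : a < b) (hb : b ≤ 1) {u : ℝ} (hu : u ∈ Ioo (0 : ℝ) 1) :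
    leftQuantile (concentration F (Ioc a b)) u =
      if u ∈ Ioc a b then ⨍ v in Ioc a b, leftQuantile F v else leftQuantile F u := by
  set m := ⨍ v in Ioc a b, leftQuantile F v with hm
  set φ : ℝ → ℝ := fun u => if u ∈ Ioc a b then m else leftQuantile F u with hφ
  have hconc : concentration F (Ioc a b) = (volume.restrict (Icc (0 : ℝ) 1)).map φ := by
    rw [concentration]
    congr 1
    funext v
    by_cases hv : v ∈ Ioc a b <;> simp only [indicator, mem_compl_iff, hv, hφ, ← hm] <;> simp
  have hlow : ∀ v ∈ Ioo (0 : ℝ) 1, v ≤ a → φ v = leftQuantile F v := fun v _ hva =>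
    if_neg fun h => absurd h.1 (not_lt.2 hva)
  have hhigh : ∀ v, b < v → φ v = leftQuantile F v := fun v hvb =>
    if_neg fun h => absurd h.2 (not_le.2 hvb)
  have hmid : ∀ v ∈ Ioc a b, φ v = m := fun v hv => if_pos hv
  have hmono : MonotoneOn φ (Ioo 0 1) := by
    intro v hv w hw hvw
    rcases le_or_gt v a with hva | hva
    · rw [hlow v hv hva]
      rcases le_or_gt w a with hwa | hwa
      · rw [hlow w hw hwa]; exact monotoneOn_leftQuantile F hv hw hvw
      rcases le_or_gt w b with hwb | hwb
      · rw [hmid w ⟨hwa, hwb⟩]; exact le_setAverage_leftQuantile hF ha hab hb hv hva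
      · rw [hhigh w hwb]; exact monotoneOn_leftQuantile F hv hw hvw
    rcases le_or_gt v b with hvb | hvb
    · rw [hmid v ⟨hva, hvb⟩]
      rcases le_or_gt w b with hwb | hwb
      · rw [hmid w ⟨hva.trans_le hvw, hwb⟩]
      · rw [hhigh w hwb]; exact setAverage_leftQuantile_le hF ha hab hb hw hwb.le
    · rw [hhigh v hvb, hhigh w (hvb.trans_le hvw)]; exact monotoneOn_leftQuantile F hv hw hvw
  rw [hconc]
  refine leftQuantile_map_of_monotoneOn hmono (fun v hv x hx => ?_) hu
  rcases le_or_gt v a with hva | hva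
  · rw [hlow v hv hva] at hx
    obtain ⟨w, hw, hxw⟩ := exists_lt_leftQuantile_of_lt F hv hx
    exact ⟨w, hw, by rwa [hlow w ⟨hw.1, hw.2.trans hv.2⟩ (hw.2.le.trans hva)]⟩
  rcases le_or_gt v b with hvb | hvb
  · obtain ⟨w, hw1, hw2⟩ := exists_between hva
    rw [hmid v ⟨hva, hvb⟩] at hx
    exact ⟨w, ⟨ha.trans_lt hw1, hw2⟩, by rwa [hmid w ⟨hw1, hw2.le.trans hvb⟩]⟩
  · rw [hhigh v hvb] at hx
    obtain ⟨w, hw, hxw⟩ := exists_lt_leftQuantile_of_lt F hv hx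
    obtain ⟨w', h1, h2⟩ := exists_between (max_lt hw.2 hvb)
    have hww' := (le_max_left w b).trans h1.le
    have h0 := hw.1.trans_le hww'
    refine ⟨w', ⟨h0, h2⟩, ?_⟩
    rw [hhigh w' ((le_max_right w b).trans_lt h1)]
    exact hxw.trans_le (monotoneOn_leftQuantile F ⟨hw.1, hw.2.trans hv.2⟩ ⟨h0, h2.trans hv.2⟩ hww')

/-- The range of integration either contains the concentrated interval up to a null set, where
averaging preserves the integral, or misses it. -/
theorem setIntegral_leftQuantile_concentration_Ioc {F : Measure ℝ} (hF : F ∈ FiniteMean ℝ)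
    {a b : ℝ} (ha : 0 ≤ a) (hab : a < b) (hb : b ≤ 1) {r : ℝ} (hr : 0 ≤ r) (hrab : r ≤ a ∨ b ≤ r) :
    ∫ u in Ioo r 1, leftQuantile (concentration F (Ioc a b)) u = ∫ u in Ioo r 1, leftQuantile F u := by
  have hI : ∀ {u}, u ∈ Ioo r 1 → u ∈ Ioo (0 : ℝ) 1 := fun hu => ⟨hr.trans_lt hu.1, hu.2⟩
  have hint := integrableOn_leftQuantile hF
  rcases hrab with hra | hbr
  · set m := ⨍ v in Ioc a b, leftQuantile F v with hm
    have hsub : Ioc a b ⊆ Icc 0 1 := fun v hv => ⟨ha.trans hv.1.le, hv.2.trans hb⟩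
    have hintC := hint.mono_set hsub
    have hintI := hint.mono_set (Ioo_subset_Icc_self.trans (Icc_subset_Icc_left hr) :
      Ioo r 1 ⊆ Icc 0 1)
    have hconst : IntegrableOn (fun _ : ℝ => m) (Ioc a b) := integrableOn_const (by simp)
    have hintd : IntegrableOn (fun u => m - leftQuantile F u) (Ioc a b) := hconst.sub hintC
    have hzero : ∫ u in Ioc a b, (m - leftQuantile F u) = 0 := by
      rw [integral_sub hconst hintC, setIntegral_const, hm, setAverage_eq,
        Real.volume_real_Ioc_of_le hab.le, smul_inv_smul₀ (by linarith), sub_self]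
    calc _ = ∫ u in Ioo r 1, (leftQuantile F u
          + (Ioc a b).indicator (fun u => m - leftQuantile F u) u) := by
          refine setIntegral_congr_fun measurableSet_Ioo fun u hu => ?_
          simp only [leftQuantile_concentration_Ioc hF ha hab hb (hI hu), ← hm]
          by_cases hC : u ∈ Ioc a b <;> simp only [hC, indicator] <;> simp
      _ = (∫ u in Ioo r 1, leftQuantile F u)
          + ∫ u in Ioo r 1, (Ioc a b).indicator (fun u => m - leftQuantile F u) u :=
          integral_add hintI ((integrable_indicator_iff measurableSet_Ioc).2 hintd).integrableOn
      _ = _ := by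
        rw [setIntegral_congr_set (f := (Ioc a b).indicator _) Ioo_ae_eq_Ioc,
          setIntegral_indicator measurableSet_Ioc, inter_eq_right.2 (Ioc_subset_Ioc hra hb), hzero,
          add_zero]
  · refine setIntegral_congr_fun measurableSet_Ioo fun u hu => ?_
    simp only [leftQuantile_concentration_Ioc hF ha hab hb (hI hu)]
    exact if_neg fun h => absurd (hbr.trans_lt hu.1) (not_lt.2 h.2)

/-! ### Riskmetrics as integrals of the quantile -/

theorem real_Ioi_eq_one_sub_cdf (F : Measure ℝ) [IsProbabilityMeasure F] (x : ℝ) :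
    F.real (Ioi x) = 1 - cdf F x := by
  rw [cdf_eq_real, ← compl_Iic, probReal_compl_eq_one_sub measurableSet_Iic]

theorem real_Ioi_mem_Icc (F : Measure ℝ) [IsProbabilityMeasure F] (x : ℝ) :
    F.real (Ioi x) ∈ Icc (0 : ℝ) 1 := ⟨measureReal_nonneg, measureReal_le_one⟩

theorem ite_sign_eq_indicator (x q : ℝ) :
    (if 0 < x then (if ¬q ≤ x then 1 else 0) else (if q ≤ x then -1 else 0) : ℝ) =
        (Ioo 0 q).indicator (fun _ => 1) x - (Icc q 0).indicator (fun _ => 1) x ∧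
      ‖(if 0 < x then (if ¬q ≤ x then 1 else 0) else (if q ≤ x then -1 else 0) : ℝ)‖ =
        (Ioo 0 q).indicator (fun _ => 1) x + (Icc q 0).indicator (fun _ => 1) x := by
  simp only [indicator, mem_Ioo, mem_Icc]
  rcases lt_or_ge 0 x with hx | hx <;> rcases lt_or_ge x q with hq | hq
  · simp [hx, hq, hx.not_ge]
  · simp [hx, hq, hx.not_ge, hq.not_gt]
  · simp [hx, hq, hx.not_gt, hq.not_ge]
  · simp [hx, hq, hx.not_gt, hq.not_gt]

/-- Fubini for a signed layer-cake kernel K: integrating K x u over x gives F⁻¹(u), while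
integrating over u in (1 - p, 1) gives the distortion integrand of min(·, p). -/
theorem distortionIntegrand_min {F : Measure ℝ} (hF : F ∈ FiniteMean ℝ) {p : ℝ}
    (hp : p ∈ Ioc (0 : ℝ) 1) :
    Integrable (distortionIntegrand (min · p) F) ∧
      ∫ x, distortionIntegrand (min · p) F x = ∫ u in Ioo (1 - p) 1, leftQuantile F u := by
  have := hF.1
  have hcdf : Measurable (cdf F) := (monotone_cdf F).measurable
  set ν : Measure ℝ := volume.restrict (Ioo (1 - p) 1) with hν
  set K : ℝ → ℝ → ℝ := fun x u =>
    if 0 < x then (if cdf F x < u then 1 else 0) else (if u ≤ cdf F x then -1 else 0) with hK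
  have hKm : Measurable (Function.uncurry K) := by
    refine Measurable.ite (measurableSet_lt measurable_const measurable_fst) ?_ ?_
    · exact Measurable.ite (measurableSet_lt (hcdf.comp measurable_fst) measurable_snd)
        measurable_const measurable_const
    · exact Measurable.ite (measurableSet_le measurable_snd (hcdf.comp measurable_fst))
        measurable_const measurable_const
  have hI : ∀ {u}, u ∈ Ioo (1 - p) 1 → u ∈ Ioo (0 : ℝ) 1 := fun hu =>
    ⟨by linarith [hu.1, hp.2], hu.2⟩
  have hKu : ∀ u ∈ Ioo (0 : ℝ) 1, ∀ x, K x u = (Ioo 0 (leftQuantile F u)).indicator (fun _ => 1) x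
      - (Icc (leftQuantile F u) 0).indicator (fun _ => 1) x := by
    intro u hu x
    simp only [hK, ← leftQuantile_le_iff F hu, ← not_le (a := u)]
    exact (ite_sign_eq_indicator x (leftQuantile F u)).1
  have hKuabs : ∀ u ∈ Ioo (0 : ℝ) 1, ∀ x, ‖K x u‖ =
      (Ioo 0 (leftQuantile F u)).indicator (fun _ => 1) x
        + (Icc (leftQuantile F u) 0).indicator (fun _ => 1) x := by
    intro u hu x
    simp only [hK, ← leftQuantile_le_iff F hu, ← not_le (a := u)]
    exact (ite_sign_eq_indicator x (leftQuantile F u)).2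
  have hi1 : ∀ a b : ℝ, Integrable ((Ioo a b).indicator (fun _ => (1 : ℝ))) := fun a b =>
    (integrable_indicator_iff measurableSet_Ioo).2 (integrableOn_const (by simp))
  have hi2 : ∀ a b : ℝ, Integrable ((Icc a b).indicator (fun _ => (1 : ℝ))) := fun a b =>
    (integrable_indicator_iff measurableSet_Icc).2 (integrableOn_const (by simp))
  have hv1 : ∀ a b : ℝ, ∫ x, (Ioo a b).indicator (fun _ => (1 : ℝ)) x = max (b - a) 0 := fun a b => by
    rw [integral_indicator measurableSet_Ioo, setIntegral_const, Real.volume_real_Ioo]; simp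
  have hv2 : ∀ a b : ℝ, ∫ x, (Icc a b).indicator (fun _ => (1 : ℝ)) x = max (b - a) 0 := fun a b => by
    rw [integral_indicator measurableSet_Icc, setIntegral_const, Real.volume_real_Icc]; simp
  have hIu : ∀ u ∈ Ioo (0 : ℝ) 1, ∫ x, K x u = leftQuantile F u := by
    intro u hu
    simp only [hKu u hu]
    rw [integral_sub (hi1 _ _) (hi2 _ _), hv1, hv2]
    rcases le_total (leftQuantile F u) 0 with h | h
    · rw [max_eq_right (by linarith), max_eq_left (by linarith)]; ring
    · rw [max_eq_left (by linarith), max_eq_right (by linarith)]; ring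
  have hIuabs : ∀ u ∈ Ioo (0 : ℝ) 1, ∫ x, ‖K x u‖ = |leftQuantile F u| := by
    intro u hu
    simp only [hKuabs u hu]
    rw [integral_add (hi1 _ _) (hi2 _ _), hv1, hv2]
    rcases le_total (leftQuantile F u) 0 with h | h
    · rw [max_eq_right (by linarith), max_eq_left (by linarith), abs_of_nonpos h]; ring
    · rw [max_eq_left (by linarith), max_eq_right (by linarith), abs_of_nonneg h]; ring
  have hq : Integrable (leftQuantile F) ν :=
    (integrableOn_leftQuantile hF).mono_set
      (Ioo_subset_Icc_self.trans (Icc_subset_Icc_left (by linarith [hp.2])))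
  have hae : ∀ᵐ u ∂ν, u ∈ Ioo (0 : ℝ) 1 :=
    (ae_restrict_mem measurableSet_Ioo).mono fun u hu => hI hu
  have hint : Integrable (Function.uncurry K) (volume.prod ν) := by
    refine (integrable_prod_iff' hKm.aestronglyMeasurable).2 ⟨?_, ?_⟩
    · filter_upwards [hae] with u hu
      exact ((hi1 _ _).sub (hi2 _ _)).congr (Filter.Eventually.of_forall fun x => (hKu u hu x).symm)
    · refine hq.norm.congr ?_
      filter_upwards [hae] with u hu
      exact (hIuabs u hu).symm
  have hJ : ∀ x, ∫ u, K x u ∂ν = distortionIntegrand (min · p) F x := by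
    intro x
    have h0 := cdf_nonneg F x
    have h1 := cdf_le_one F x
    simp only [hK, distortionIntegrand, real_Ioi_eq_one_sub_cdf, min_eq_right hp.2]
    split_ifs with hx
    · have : (fun u => if cdf F x < u then (1 : ℝ) else 0) =
          (Ioi (cdf F x)).indicator fun _ => 1 := by
        funext u; simp only [indicator, mem_Ioi]
      rw [this, integral_indicator measurableSet_Ioi, hν, Measure.restrict_restrict measurableSet_Ioi,
        setIntegral_const, inter_comm, Ioo_inter_Ioi, Real.volume_real_Ioo_of_le
          (max_le (by linarith [hp.1]) h1), smul_eq_mul, mul_one]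
      rcases le_total (1 - p) (cdf F x) with h | h
      · rw [sup_eq_right.2 h, min_eq_left (by linarith)]
      · rw [sup_eq_left.2 h, min_eq_right (by linarith)]; ring
    · have : (fun u => if u ≤ cdf F x then (-1 : ℝ) else 0) =
          (Iic (cdf F x)).indicator fun _ => -1 := by
        funext u; simp only [indicator, mem_Iic]
      rw [this, integral_indicator measurableSet_Iic, hν,
        setIntegral_congr_set (s := Iic (cdf F x)) (Iio_ae_eq_Iic' (by simp)).symm,
        Measure.restrict_restrict measurableSet_Iio,
        setIntegral_const, inter_comm, Ioo_inter_Iio, min_eq_right h1, Real.volume_real_Ioo, smul_eq_mul]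
      rcases le_total (1 - p) (cdf F x) with h | h
      · rw [max_eq_left (by linarith), min_eq_left (by linarith)]; ring
      · rw [max_eq_right (by linarith), min_eq_right (by linarith)]; ring
  have hswap := integral_integral_swap hint
  simp only [hJ] at hswap
  refine ⟨?_, ?_⟩
  · have := hint.integral_prod_left
    simpa only [Function.uncurry, hJ] using this
  · rw [hswap, hν]
    exact setIntegral_congr_fun measurableSet_Ioo fun u hu => hIu u (hI hu)

theorem distortionRiskmetric_eq_integral {h : ℝ → ℝ} {F : Measure ℝ}
    (hint : Integrable (distortionIntegrand h F)) :
    distortionRiskmetric h F = ((∫ x, distortionIntegrand h F x : ℝ) : EReal) := by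
  have h1 := hint.lintegral_lt_top.ne
  have h2 := hint.neg.lintegral_lt_top.ne
  simp only [Pi.neg_apply] at h2
  rw [distortionRiskmetric, integral_eq_lintegral_pos_part_sub_lintegral_neg_part hint,
    EReal.coe_sub, EReal.coe_ennreal_toReal h1, EReal.coe_ennreal_toReal h2]

theorem distortionIntegrand_knotFunction {F : Measure ℝ} (hF : F ∈ FiniteMean ℝ) (Q : Finset ℝ)
    (hQ : ∀ p ∈ Q, p ∈ Ioo (0 : ℝ) 1) (c : ℝ → ℝ) (m : ℝ) :
    Integrable (distortionIntegrand (knotFunction Q c m) F) ∧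
      ∫ x, distortionIntegrand (knotFunction Q c m) F x =
        m * (∫ u in Ioo 0 1, leftQuantile F u) + ∑ p ∈ Q, c p *
          ((∫ u in Ioo (1 - p) 1, leftQuantile F u) - p * ∫ u in Ioo 0 1, leftQuantile F u) := by
  have := hF.1
  obtain ⟨h1, h1'⟩ := distortionIntegrand_min hF (p := 1) (by simp)
  rw [sub_self] at h1'
  have hp := fun p hp => distortionIntegrand_min hF (Ioo_subset_Ioc_self (hQ p hp))
  have heq : distortionIntegrand (knotFunction Q c m) F = fun x =>
      m * distortionIntegrand (min · 1) F x + ∑ p ∈ Q, c p * (distortionIntegrand (min · p) F x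
        - p * distortionIntegrand (min · 1) F x) := by
    funext x
    simp only [distortionIntegrand, min_eq_left (real_Ioi_mem_Icc F x).2, min_self]
    split_ifs
    · rfl
    · simp only [knotFunction]
      rw [add_sub_add_comm, ← Finset.sum_sub_distrib, mul_sub]
      congr 1
      exact Finset.sum_congr rfl fun p _ => by ring
  have hi : ∀ p ∈ Q, Integrable fun x => c p * (distortionIntegrand (min · p) F x
      - p * distortionIntegrand (min · 1) F x) := fun p hpQ =>
    ((hp p hpQ).1.sub (h1.const_mul p)).const_mul (c p)
  rw [heq]
  refine ⟨(h1.const_mul m).add (integrable_finsetSum _ hi), ?_⟩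
  rw [integral_add (h1.const_mul m) (integrable_finsetSum _ hi), integral_finsetSum _ hi,
    integral_const_mul, h1']
  congr 1
  refine Finset.sum_congr rfl fun p hpQ => ?_
  rw [integral_const_mul, integral_sub (hp p hpQ).1 (h1.const_mul p), integral_const_mul, h1',
    (hp p hpQ).2]

/-! ### Monotonicity and monotone limits of the riskmetric -/

theorem distortionRiskmetric_mono {h k : ℝ → ℝ} {F : Measure ℝ} [IsProbabilityMeasure F]
    (hle : ∀ t ∈ Icc (0 : ℝ) 1, h t ≤ k t) (h1 : k 1 = h 1) :
    distortionRiskmetric h F ≤ distortionRiskmetric k F := by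
  have hi : ∀ x, distortionIntegrand h F x ≤ distortionIntegrand k F x := by
    intro x
    have := hle _ (real_Ioi_mem_Icc F x)
    simp only [distortionIntegrand, h1]
    split_ifs <;> linarith
  refine EReal.sub_le_sub ?_ ?_ <;> rw [EReal.coe_ennreal_le_coe_ennreal_iff]
  · exact lintegral_mono fun x => ENNReal.ofReal_le_ofReal (hi x)
  · exact lintegral_mono fun x => ENNReal.ofReal_le_ofReal (neg_le_neg (hi x))

theorem measurable_distortionIntegrand {h : ℝ → ℝ} (hh : Measurable h) (F : Measure ℝ)
    [IsProbabilityMeasure F] : Measurable (distortionIntegrand h F) := by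
  have hS : Measurable fun x => F.real (Ioi x) := by
    simp only [real_Ioi_eq_one_sub_cdf]
    exact measurable_const.sub (monotone_cdf F).measurable
  exact Measurable.ite measurableSet_Ioi (hh.comp hS) ((hh.comp hS).sub measurable_const)

open Filter Topology in
theorem distortionRiskmetric_le_of_tendsto {g : ℕ → ℝ → ℝ} {L : ℝ → ℝ} {F : Measure ℝ}
    [IsProbabilityMeasure F] (hg : ∀ n, Measurable (g n))
    (hmono : ∀ t ∈ Icc (0 : ℝ) 1, Monotone fun n => g n t)
    (htend : ∀ t ∈ Icc (0 : ℝ) 1, Tendsto (fun n => g n t) atTop (𝓝 (L t)))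
    (h1 : ∀ n, g n 1 = L 1) (hint : Integrable (distortionIntegrand (g 0) F)) {v : EReal}
    (hv : ∀ n, distortionRiskmetric (g n) F ≤ v) : distortionRiskmetric L F ≤ v := by
  have hm : ∀ n, Measurable (distortionIntegrand (g n) F) := fun n =>
    measurable_distortionIntegrand (hg n) F
  have him : ∀ x, Monotone fun n => distortionIntegrand (g n) F x := by
    intro x i j hij
    have := hmono _ (real_Ioi_mem_Icc F x) hij
    simp only [distortionIntegrand, h1] at this ⊢
    split_ifs <;> linarith
  have hit : ∀ x, Tendsto (fun n => distortionIntegrand (g n) F x) atTop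
      (𝓝 (distortionIntegrand L F x)) := by
    intro x
    have := htend _ (real_Ioi_mem_Icc F x)
    simp only [distortionIntegrand, h1]
    split_ifs
    · exact this
    · exact this.sub_const _
  have hpos := lintegral_tendsto_of_tendsto_of_monotone (μ := volume)
    (fun n => ((hm n).ennreal_ofReal).aemeasurable)
    (Eventually.of_forall fun x i j hij => ENNReal.ofReal_le_ofReal (him x hij))
    (Eventually.of_forall fun x => (ENNReal.continuous_ofReal.tendsto _).comp (hit x))
  have h0 := hint.neg.lintegral_lt_top.ne
  simp only [Pi.neg_apply] at h0
  have hneg := lintegral_tendsto_of_tendsto_of_antitone (μ := volume)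
    (fun n => ((hm n).neg.ennreal_ofReal).aemeasurable)
    (Eventually.of_forall fun x i j hij => ENNReal.ofReal_le_ofReal (neg_le_neg (him x hij))) h0
    (Eventually.of_forall fun x => (ENNReal.continuous_ofReal.tendsto _).comp (hit x).neg)
  have hfin : ∫⁻ x, ENNReal.ofReal (-distortionIntegrand L F x) ≠ ⊤ := by
    refine ne_top_of_le_ne_top h0 (lintegral_mono fun x => ENNReal.ofReal_le_ofReal ?_)
    exact neg_le_neg ((him x).ge_of_tendsto (hit x) 0)
  -- The positive parts may have infinite limit, but the negative parts stay bounded by that of g 0,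
  -- so the extended subtraction is continuous at the limit.
  refine le_of_tendsto' (x := atTop) ?_ hv
  refine (EReal.continuousAt_add (p := (_, -_)) ?_ ?_).tendsto.comp
    ((EReal.tendsto_coe_ennreal.2 hpos).prodMk_nhds
      ((continuous_neg.tendsto _).comp (EReal.tendsto_coe_ennreal.2 hneg)))
  · right; simpa using hfin
  · left; simp

/-! ### Concentration on a partition and the main inequality -/

theorem exists_mem_cdf_mem_of_closedUnderConcentration {N : Set (Measure ℝ)} (hN : N ⊆ FiniteMean ℝ)
    (hcl : ClosedUnderConcentration N) {F : Measure ℝ} (hF : F ∈ N) {R : Finset ℝ}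
    (hR : ∀ r ∈ R, r ∈ Ioo (0 : ℝ) 1) :
    ∃ F' ∈ N, (∀ r ∈ insert 0 R,
        ∫ u in Ioo r 1, leftQuantile F' u = ∫ u in Ioo r 1, leftQuantile F u) ∧
      ∀ x, cdf F' x ∈ insert 0 (insert 1 R) := by
  classical
  have hE01 : ∀ e ∈ insert 1 R, 0 < e ∧ e ≤ 1 := by
    intro e he
    rcases Finset.mem_insert.1 he with rfl | he
    · simp
    · exact ⟨(hR e he).1, (hR e he).2.le⟩
  have hR01 : ∀ r ∈ insert 0 R, 0 ≤ r ∧ r < 1 := by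
    intro e he
    rcases Finset.mem_insert.1 he with rfl | he
    · simp
    · exact ⟨(hR e he).1.le, (hR e he).2⟩
  -- The partition cell ending at e is (a e, e], with a e the predecessor of e in {0} ∪ R.
  have hpred : ∀ e : ℝ, ∃ a : ℝ, e ∈ insert 1 R →
      a ∈ insert 0 R ∧ a < e ∧ ∀ r ∈ insert 0 R, r < e → r ≤ a := by
    intro e
    by_cases he : e ∈ insert 1 R
    · obtain ⟨a, ha, hmax⟩ := ((insert 0 R).filter (· < e)).exists_max_image id
        ⟨0, by simp [(hE01 e he).1]⟩
      rw [Finset.mem_filter] at ha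
      exact ⟨a, fun _ => ⟨ha.1, ha.2, fun r hr hre => hmax r (Finset.mem_filter.2 ⟨hr, hre⟩)⟩⟩
    · exact ⟨0, fun h => absurd h he⟩
  choose a ha using hpred
  -- One cell is concentrated at a time; as cells are disjoint, the quantile stays constant on those
  -- already treated.
  have hstep : ∀ E : Finset ℝ, E ⊆ insert 1 R → ∃ F' ∈ N, (∀ r ∈ insert 0 R,
        ∫ u in Ioo r 1, leftQuantile F' u = ∫ u in Ioo r 1, leftQuantile F u) ∧
      ∀ e ∈ E, ∀ u ∈ Ioo (0 : ℝ) 1, ∀ v ∈ Ioo (0 : ℝ) 1, u ∈ Ioc (a e) e → v ∈ Ioc (a e) e →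
        leftQuantile F' u = leftQuantile F' v := by
    intro E
    induction E using Finset.induction_on with
    | empty => exact fun _ => ⟨F, hF, fun _ _ => rfl, by simp⟩
    | insert e E heE ih =>
      intro hsub
      obtain ⟨F', hF'N, hF'int, hF'const⟩ := ih fun x hx => hsub (Finset.mem_insert_of_mem hx)
      have he := hsub (Finset.mem_insert_self e E)
      obtain ⟨haR, hae, hamax⟩ := ha e he
      have h0a := (hR01 _ haR).1
      have he1 := (hE01 e he).2
      refine ⟨concentration F' (Ioc (a e) e), hcl F' hF'N _ ordConnected_Ioc
        fun v hv => ⟨h0a.trans hv.1.le, hv.2.trans he1⟩, fun r hr => ?_, ?_⟩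
      · rw [setIntegral_leftQuantile_concentration_Ioc (hN hF'N) h0a hae he1 (hR01 r hr).1,
          hF'int r hr]
        rcases lt_or_ge r e with h | h
        · exact Or.inl (hamax r hr h)
        · exact Or.inr h
      · intro e' he' u hu v hv hue hve
        rw [leftQuantile_concentration_Ioc (hN hF'N) h0a hae he1 hu,
          leftQuantile_concentration_Ioc (hN hF'N) h0a hae he1 hv]
        rcases Finset.mem_insert.1 he' with rfl | he'E
        · rw [if_pos hue, if_pos hve]
        have he'R := hsub he'
        have hdisj : ∀ w ∈ Ioc (a e') e', w ∉ Ioc (a e) e := by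
          intro w hw hw'
          rcases lt_trichotomy e' e with h | rfl | h
          · have : e' ∈ insert 0 R := by
              rcases Finset.mem_insert.1 he'R with rfl | h'
              · exact absurd h he1.not_gt
              · exact Finset.mem_insert_of_mem h'
            exact absurd (hw'.1.trans_le hw.2) (hamax e' this h).not_gt
          · exact heE he'E
          · have : e ∈ insert 0 R := by
              rcases Finset.mem_insert.1 he with rfl | h'
              · exact absurd h (hE01 e' he'R).2.not_gt
              · exact Finset.mem_insert_of_mem h'
            exact absurd (hw.1.trans_le hw'.2) ((ha e' he'R).2.2 e this h).not_gt
        rw [if_neg (hdisj u hue), if_neg (hdisj v hve)]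
        exact hF'const e' he'E u hu v hv hue hve
  obtain ⟨F', hF'N, hF'int, hF'const⟩ := hstep _ subset_rfl
  refine ⟨F', hF'N, hF'int, fun x => ?_⟩
  by_contra hx
  simp only [Finset.mem_insert, not_or] at hx
  obtain ⟨hx0, hx1, hxR⟩ := hx
  have h0 : 0 < cdf F' x := lt_of_le_of_ne (cdf_nonneg _ _) (Ne.symm hx0)
  have h1 : cdf F' x < 1 := lt_of_le_of_ne (cdf_le_one _ _) hx1
  obtain ⟨e, he, hmin⟩ := ((insert 1 R).filter (cdf F' x < ·)).exists_min_image id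
    ⟨1, by simp [h1]⟩
  rw [Finset.mem_filter] at he
  obtain ⟨heE, hxe⟩ := he
  obtain ⟨haR, hae, -⟩ := ha e heE
  have hax : a e < cdf F' x := by
    rcases Finset.mem_insert.1 haR with h | h
    · rwa [h]
    · refine lt_of_le_of_ne (le_of_not_gt fun hlt => ?_) fun heq => hxR (heq ▸ h)
      exact absurd (hmin (a e) (Finset.mem_filter.2 ⟨Finset.mem_insert_of_mem h, hlt⟩)) hae.not_ge
  -- If cdf F' x lay strictly inside a cell, constancy of the quantile there would give F'⁻¹(w) ≤ x
  -- for some w above cdf F' x, a contradiction.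
  obtain ⟨w, hw1, hw2⟩ := exists_between hxe
  have hwI : w ∈ Ioo (0 : ℝ) 1 := ⟨h0.trans hw1, hw2.trans_le (hE01 e heE).2⟩
  have hle := (leftQuantile_le_iff F' ⟨h0, h1⟩ x).2 le_rfl
  rw [hF'const e heE _ ⟨h0, h1⟩ w hwI ⟨hax, hxe.le⟩ ⟨hax.trans hw1, hw2.le⟩,
    leftQuantile_le_iff F' hwI] at hle
  exact absurd hw1 hle.not_gt

theorem exists_mem_distortionRiskmetric_eq_knotFunction {N : Set (Measure ℝ)}
    (hN : N ⊆ FiniteMean ℝ) (hcl : ClosedUnderConcentration N) {F : Measure ℝ} (hF : F ∈ N)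
    {h : ℝ → ℝ} (h0 : h 0 = 0) {Q : Finset ℝ} (hQ : ∀ p ∈ Q, p ∈ Ioo (0 : ℝ) 1) {c : ℝ → ℝ}
    (hhQ : ∀ p ∈ Q, knotFunction Q c (h 1) p = h p) :
    ∃ F' ∈ N, distortionRiskmetric h F' = distortionRiskmetric (knotFunction Q c (h 1)) F := by
  classical
  obtain ⟨F', hF'N, hint, hcdf⟩ := exists_mem_cdf_mem_of_closedUnderConcentration hN hcl hF
    (R := Q.image (1 - ·)) fun r hr => by
      obtain ⟨p, hp, rfl⟩ := Finset.mem_image.1 hr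
      exact ⟨by linarith [(hQ p hp).2], by linarith [(hQ p hp).1]⟩
  refine ⟨F', hF'N, ?_⟩
  have := (hN hF'N).1
  -- The survival function of F' visits only points where h and the hull agree.
  have heq : distortionIntegrand h F' = distortionIntegrand (knotFunction Q c (h 1)) F' := by
    funext x
    have hx : h (F'.real (Ioi x)) = knotFunction Q c (h 1) (F'.real (Ioi x)) := by
      rw [real_Ioi_eq_one_sub_cdf]
      have := hcdf x
      simp only [Finset.mem_insert, Finset.mem_image] at this
      rcases this with h' | h' | ⟨p, hp, h'⟩
      · rw [h', sub_zero, knotFunction_one hQ]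
      · rw [h', sub_self, knotFunction_zero hQ, h0]
      · rw [← h', sub_sub_cancel, hhQ p hp]
    simp only [distortionIntegrand, hx, knotFunction_one hQ]
  obtain ⟨hi, hv⟩ := distortionIntegrand_knotFunction (hN hF) Q hQ c (h 1)
  obtain ⟨hi', hv'⟩ := distortionIntegrand_knotFunction (hN hF'N) Q hQ c (h 1)
  rw [distortionRiskmetric_eq_integral hi, distortionRiskmetric_eq_integral (heq ▸ hi'), heq, hv,
    hv', hint 0 (Finset.mem_insert_self _ _)]
  congr 2
  exact Finset.sum_congr rfl fun p hp => by
    rw [hint (1 - p) (Finset.mem_insert_of_mem (Finset.mem_image_of_mem _ hp))]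

theorem iSup_distortionRiskmetric_concaveEnvelope {N : Set (Measure ℝ)} (hN : N ⊆ FiniteMean ℝ)
    (hcl : ClosedUnderConcentration N) {h : ℝ → ℝ} (hh : h ∈ DistortionFunctions) :
    ⨆ F ∈ N, distortionRiskmetric (concaveEnvelope h) F = ⨆ F ∈ N, distortionRiskmetric h F := by
  obtain ⟨B, hB⟩ := exists_forall_le_of_mem_distortionFunctions hh
  obtain ⟨Q, c, L, hQ, hhQ, hmono, htend, hLD, hLc, hhL⟩ := exists_knotFunction_tendsto_hull hh.2 hB
  have hL1 : L 1 = h 1 := by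
    refine tendsto_nhds_unique (htend 1 (by simp)) ?_
    simp only [knotFunction_one (hQ _)]
    exact tendsto_const_nhds
  have hle := fun t ht => le_concaveEnvelope hLD hLc hhL (t := t) ht
  have hleL := fun t ht => concaveEnvelope_le hLD hLc hhL (t := t) ht
  -- Equal values at 1 are needed because the integrand subtracts them on the negative half-line.
  have h1 : concaveEnvelope h 1 = h 1 :=
    le_antisymm ((hleL 1 (by simp)).trans hL1.le) (hle 1 (by simp))
  refine le_antisymm (iSup₂_le fun F hF => ?_) (iSup₂_mono fun F hF => ?_)
  · have := (hN hF).1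
    refine (distortionRiskmetric_mono hleL (hL1.trans h1.symm)).trans ?_
    refine distortionRiskmetric_le_of_tendsto
      (fun n => (continuous_knotFunction (Q n) (c n) (h 1)).measurable) hmono htend
      (fun n => by rw [knotFunction_one (hQ n), hL1])
      (distortionIntegrand_knotFunction (hN hF) (Q 0) (hQ 0) _ _).1 fun n => ?_
    obtain ⟨F', hF', heq⟩ :=
      exists_mem_distortionRiskmetric_eq_knotFunction hN hcl hF hh.2 (hQ n) (hhQ n)
    rw [← heq]
    exact le_iSup₂_of_le F' hF' le_rfl
  · have := (hN hF).1
    exact distortionRiskmetric_mono hle h1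

theorem proposition7 {d n : ℕ}
    (f : EuclideanSpace ℝ (Fin d) → EuclideanSpace ℝ (Fin n) → ℝ)
    (A : Set (EuclideanSpace ℝ (Fin d)))
    (M : Set (Measure (EuclideanSpace ℝ (Fin n))))
    (hM : M ⊆ FiniteMean (EuclideanSpace ℝ (Fin n)))
    (hf : ∀ a ∈ A, Measurable (f a))
    (hfM : ∀ a ∈ A, ∀ P ∈ M, P.map (f a) ∈ FiniteMean ℝ)
    (hclosed : ∀ a ∈ A, ClosedUnderConcentration ((fun P => P.map (f a)) '' M))
    (G : Set (ℝ → ℝ)) (hG : G ⊆ DistortionFunctions) :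
    (⨅ a ∈ A, worstCase f M G a) = (⨅ a ∈ A, worstCase f M (concaveEnvelope '' G) a) ∧
    ∀ v : EReal, IsLeast (worstCase f M G '' A) v ↔
      IsLeast (worstCase f M (concaveEnvelope '' G) '' A) v := by
  have key : ∀ a ∈ A, worstCase f M G a = worstCase f M (concaveEnvelope '' G) a := by
    intro a ha
    have hN : (fun P => P.map (f a)) '' M ⊆ FiniteMean ℝ := by
      rintro _ ⟨P, hP, rfl⟩
      exact hfM a ha P hP
    have hswap : ∀ K : Set (ℝ → ℝ), worstCase f M K a =
        ⨆ k ∈ K, ⨆ F ∈ (fun P => P.map (f a)) '' M, distortionRiskmetric k F := by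
      intro K
      simp only [worstCase, iSup_image]
      exact iSup₂_comm _
    rw [hswap, hswap, iSup_image]
    exact biSup_congr fun h hh =>
      (iSup_distortionRiskmetric_concaveEnvelope hN (hclosed a ha) (hG hh)).symm
  refine ⟨biInf_congr key, fun v => ?_⟩
  rw [image_congr key]
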